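/- **Theorem.** An independence alphabet is a pair $(\Gamma,I)$ where $\Gamma$ is a countable (finite or countably infinite) set and $I\subseteq\Gamma^2$ is irreflexive and symmetric; it is regarded as a simple graph with vertex set $\Gamma$. The trace monoid is $\mathbb M(\Gamma,I)=\Gamma^*/{\equiv_I}$, where $\equiv_I$ is the least congruence on the free monoid $\Gamma^*$ with $ab\equiv_I ba$ for all $(a,b)\in I$. For a set $A$ with at least two elements, let $\overline A=\{\overline a: a\in A\}$ be a disjoint copy of $A$ and $\Sigma=A\cup\overline A$. The words in $\Sigma^*$ act from the right on $A^*\cup\{\bot\}$: a letter $a\in A$ (write $a$) sends $q\in A^*$ to $qa$; a letter $\overline a$ (read $a$) sends $q\in A^*$ to $q'$ if $q=aq'$ and to $\bot$ otherwise; every letter fixes $\bot$. Words $u,v\in\Sigma^*$ are equivalent, $u\equiv v$, if $q.u=q.v$ for all $q\in A^*$; this is a congruence, and the queue monoid is $Q=Q_A=\Sigma^*/{\equiv}$. A monoid embeds into another one if there is an injective monoid homomorphism from the first to the second. Let $A$ be any set with at least two elements and $Q=Q_A$. For every independence alphabet $(\Gamma,I)$, the following are equivalent: 1. $\mathbb M(\Gamma,I)$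 embeds into $Q$. 2. $\mathbb M(\Gamma,I)$ embeds into the direct product $\{a,b\}^*\times\{c,d\}^*$ of two free monoids of rank two. 3. At least one of the following holds: (a) every vertex of $(\Gamma,I)$ has degree at most $1$; or (b) $(\Gamma,I)$ has exactly one connected component $C$ that is not an isolated vertex, and $C$ is complete bipartite, that is, $C=C_1\uplus C_2$ with $I\cap C^2=(C_1\times C_2)\cup(C_2\times C_1)$. In particular, the additive monoid $\mathbb N^3$ does not embed into $Q$. -/

import Mathlib

/-- The monoid `M` embeds into the monoid `N`: there is an injective monoid homomorphism. -/
def EmbedsInto (M N : Type*) [Monoid M] [Monoid N] : Prop :=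
  ∃ f : M →* N, Function.Injective f

section Trace

variable {Γ : Type*}

/-- The congruence `≡_I`: the least congruence on the free monoid `Γ*` with `ab ≡_I ba` for all
`(a, b) ∈ I`. The symmetric irreflexive relation `I` is given as the adjacency relation of a
simple graph `G` on `Γ`. -/
def traceCon (G : SimpleGraph Γ) : Con (FreeMonoid Γ) :=
  conGen fun x y => ∃ a b : Γ, G.Adj a b ∧
    x = FreeMonoid.of a * FreeMonoid.of b ∧ y = FreeMonoid.of b * FreeMonoid.of a

/-- The trace monoid `M(Γ, I) = Γ* / ≡_I`. -/
abbrev TraceMonoid (G : SimpleGraph Γ) : Type _ := (traceCon G).Quotient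

/-- The connected component `C` is complete bipartite: it is the disjoint union of two sets
`C₁`, `C₂` with `I ∩ C² = (C₁ × C₂) ∪ (C₂ × C₁)`. -/
def IsCompleteBipartiteComponent (G : SimpleGraph Γ) (C : G.ConnectedComponent) : Prop :=
  ∃ C₁ C₂ : Set Γ, Disjoint C₁ C₂ ∧ C₁ ∪ C₂ = C.supp ∧
    ∀ a ∈ C.supp, ∀ b ∈ C.supp, G.Adj a b ↔ (a ∈ C₁ ∧ b ∈ C₂) ∨ (a ∈ C₂ ∧ b ∈ C₁)

/-- Every vertex has degree at most one (the degree may a priori be infinite). -/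
def AllDegreesLeOne (G : SimpleGraph Γ) : Prop :=
  ∀ a : Γ, (G.neighborSet a).encard ≤ 1

/-- There is exactly one connected component that is not a single isolated vertex, and this
component is complete bipartite. -/
def HasUniqueNontrivialComponentCompleteBipartite (G : SimpleGraph Γ) : Prop :=
  ∃ C : G.ConnectedComponent, C.supp.Nontrivial ∧
    (∀ C' : G.ConnectedComponent, C'.supp.Nontrivial → C' = C) ∧
    IsCompleteBipartiteComponent G C

end Trace

section Queue

/-- The basic queue actions: the alphabet `Σ = A ∪ Ā`. -/
inductive QueueAction (A : Type*) where
  /-- Write the letter `a` at the end of the queue. -/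
  | write (a : A) : QueueAction A
  /-- Read the letter `a` from the front of the queue. -/
  | read (a : A) : QueueAction A

variable {A : Type*}

open Classical in
/-- The effect of one basic action on a state in `A* ∪ {⊥}`; the error state `⊥` is `none`. -/
noncomputable def QueueAction.step : Option (List A) → QueueAction A → Option (List A)
  | none, _ => none
  | some q, .write a => some (q ++ [a])
  | some [], .read _ => none
  | some (b :: q), .read a => if b = a then some q else none

/-- The action `q.u` of a word `u ∈ Σ*` on a state `q ∈ A* ∪ {⊥}`. -/
noncomputable def queueRun (q : Option (List A)) (u : FreeMonoid (QueueAction A)) :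
    Option (List A) :=
  u.toList.foldl QueueAction.step q

theorem queueRun_mul (q : Option (List A)) (u v : FreeMonoid (QueueAction A)) :
    queueRun q (u * v) = queueRun (queueRun q u) v := by
  simp [queueRun, FreeMonoid.toList_mul, List.foldl_append]

theorem queueRun_none (u : FreeMonoid (QueueAction A)) :
    queueRun (none : Option (List A)) u = none := by
  unfold queueRun
  induction u.toList with
  | nil => rfl
  | cons x l ih => simpa [QueueAction.step] using ih

variable (A) in
/-- Two words are equivalent if they act in the same way on all queues `q ∈ A*`. -/
def queueCon : Con (FreeMonoid (QueueAction A)) where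
  r u v := ∀ q : List A, queueRun (some q) u = queueRun (some q) v
  iseqv := ⟨fun _ _ => rfl, fun h q => (h q).symm, fun h k q => (h q).trans (k q)⟩
  mul' := by
    intro u v u' v' h h' q
    rw [queueRun_mul, queueRun_mul, h q]
    cases queueRun (some q) v with
    | none => rw [queueRun_none, queueRun_none]
    | some p => exact h' p

variable (A) in
/-- The queue monoid `Q_A = Σ* / ≡`. -/
abbrev QueueMonoid : Type _ := (queueCon A).Quotient

end Queue

/-! A word over Σ has a word of writes and a word of reads, and both depend only on its class in Q.
They fall short of determining the class, which also records how long a queue must be for the run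
not to fail. This ambiguity vanishes after multiplication by a suitable word, so the pair of
projections is injective on every cancellative submonoid of Q (`projections_comp_injective`). Trace
monoids are cancellative, because projections to pairs of non-adjacent letters separate traces
(`eq_of_restrict_pair_eq`).

An embedding into Q thus yields two jointly injective morphisms p, q to a free monoid. There,
commuting with a common nontrivial word is transitive, and commuting words of equal length are
equal. Length vectors in ℤ² exclude three independent commuting elements, hence triangles and ℕ³. A
vertex with two non-adjacent neighbours must vanish under p or q, and explicit relations then
exclude induced paths on four vertices (`no_induced_path`) and edges away from a vertex of degree at
least two (`no_edge_far_from_branching`). The remaining graphs are those of condition 3.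

Conversely, for such graphs two morphisms to free monoids separate traces, and a product of two free
monoids embeds into Q by blocks of writes that commute with blocks of reads
(`embedsInto_of_nontrivial`). -/

/-! ### Commutation, codes and letter projections in free monoids. -/

namespace FreeMonoid

variable {α : Type*}

theorem eq_of_commute_of_length_eq {x y : FreeMonoid α} (h : Commute x y)
    (hl : x.length = y.length) : x = y :=
  (List.append_inj (show x.toList ++ y.toList = y.toList ++ x.toList from h.eq) hl).1

theorem length_pow (x : FreeMonoid α) (n : ℕ) : (x ^ n).length = n * x.length := by
  induction n with
  | zero => simp
  | succ n ih => rw [pow_succ, length_mul, ih]; ring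

theorem pow_length_eq_of_commute {x y : FreeMonoid α} (h : Commute x y) :
    x ^ y.length = y ^ x.length :=
  eq_of_commute_of_length_eq (h.pow_pow _ _) (by rw [length_pow, length_pow, mul_comm])

theorem length_pos_of_ne_one {x : FreeMonoid α} (h : x ≠ 1) : 0 < x.length :=
  Nat.pos_of_ne_zero fun h0 => h (length_eq_zero.1 h0)

/-- Both `x * y` and `y * x` commute with `w`, so they are prefixes of equal length of one
sufficiently long power of `w`. -/
theorem commute_trans {x w y : FreeMonoid α} (hw : w ≠ 1) (hx : Commute x w) (hy : Commute w y) :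
    Commute x y := by
  have key : ∀ (z v : FreeMonoid α), Commute z v → z.length ≤ v.length →
      z.toList = v.toList.take z.length := by
    intro z v h hl
    refine List.prefix_iff_eq_take.1 (List.prefix_of_prefix_length_le
      (l₃ := z.toList ++ v.toList) (List.prefix_append _ _) ?_ hl)
    rw [show z.toList ++ v.toList = v.toList ++ z.toList from h.eq]
    exact List.prefix_append _ _
  have hw' := length_pos_of_ne_one hw
  set n := x.length + y.length with hn
  have hle : n ≤ (w ^ n).length := by
    rw [length_pow]; exact Nat.le_mul_of_pos_right _ hw'
  have h1 := key (x * y) (w ^ n) ((hx.mul_left hy.symm).pow_right n) (by rw [length_mul]; exact hle)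
  have h2 := key (y * x) (w ^ n) ((hy.symm.mul_left hx).pow_right n)
    (by rw [length_mul, add_comm]; exact hle)
  rw [length_mul] at h1 h2
  rw [add_comm, ← h1] at h2
  exact (FreeMonoid.toList.injective h2).symm

/-- A free monoid on countably many letters embeds into the free monoid of rank two. -/
def unaryCode : FreeMonoid ℕ →* FreeMonoid (Fin 2) :=
  lift fun n => of 0 ^ n * of 1

/-- The words 0ⁿ1 form a prefix code: the zeros before the first 1 determine the first letter. -/
theorem unaryCode_injective : Function.Injective unaryCode := by
  have key : ∀ (m n : ℕ) (s t : FreeMonoid (Fin 2)),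
      of 0 ^ m * of 1 * s = of 0 ^ n * of 1 * t → m = n ∧ s = t := by
    intro m
    induction m with
    | zero =>
      intro n s t h
      cases n with
      | zero => simpa using h
      | succ n =>
        have h' := congrArg (fun z => z.toList.head?) h
        simp [pow_succ', mul_assoc] at h'
    | succ m ih =>
      intro n s t h
      cases n with
      | zero =>
        have h' := congrArg (fun z => z.toList.head?) h
        simp [pow_succ', mul_assoc] at h'
      | succ n =>
        simp only [pow_succ', mul_assoc] at h
        have := ih n s t (by simpa [mul_assoc] using mul_left_cancel h)
        exact ⟨by rw [this.1], this.2⟩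
  intro x
  induction x using FreeMonoid.inductionOn' with
  | one =>
    intro y h
    cases y using FreeMonoid.casesOn with
    | one => rfl
    | of_mul a y =>
      have := congrArg length h
      simp [unaryCode, length_mul] at this
      omega
  | of_mul a x ih =>
    intro y h
    cases y using FreeMonoid.casesOn with
    | one =>
      have := congrArg length h
      simp [unaryCode, length_mul] at this
    | of_mul b y =>
      simp only [map_mul] at h
      obtain ⟨rfl, h2⟩ := key a b _ _ (by simpa [unaryCode] using h)
      rw [ih h2]

theorem exists_injective_hom_fin_two (α : Type*) [Countable α] :
    ∃ f : FreeMonoid α →* FreeMonoid (Fin 2), Function.Injective f := by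
  obtain ⟨e, he⟩ := exists_injective_nat α
  exact ⟨unaryCode.comp (map e), unaryCode_injective.comp (List.map_injective_iff.2 he)⟩

/-- The morphism that keeps the letters in `S` and erases all others. -/
noncomputable def restrict (S : Set α) : FreeMonoid α →* FreeMonoid α := by
  classical exact lift fun a => if a ∈ S then of a else 1

theorem restrict_of_mem {S : Set α} {a : α} (h : a ∈ S) : restrict S (of a) = of a := by
  simp [restrict, h]

theorem restrict_of_notMem {S : Set α} {a : α} (h : a ∉ S) : restrict S (of a) = 1 := by
  simp [restrict, h]

theorem restrict_restrict {S T : Set α} (h : S ⊆ T) (u : FreeMonoid α) :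
    restrict S (restrict T u) = restrict S u := by
  have : (restrict S).comp (restrict T) = restrict S := by
    ext a
    by_cases hT : a ∈ T
    · simp [restrict_of_mem hT]
    · simp [restrict_of_notMem hT, restrict_of_notMem fun hS => hT (h hS)]
  exact DFunLike.congr_fun this u

theorem not_commute_of_pow {a b : α} (hab : a ≠ b) {m n : ℕ} (hm : m ≠ 0) (hn : n ≠ 0) :
    ¬ Commute (of a ^ m) (of b ^ n) := by
  intro h
  obtain ⟨m, rfl⟩ := Nat.exists_eq_succ_of_ne_zero hm
  obtain ⟨n, rfl⟩ := Nat.exists_eq_succ_of_ne_zero hn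
  have h' := congrArg (fun z => z.toList.head?) h.eq
  simp [pow_succ', mul_assoc] at h'
  exact hab h'

end FreeMonoid

/-! ### Invariants of queue words. -/

namespace QueueAction

variable {A : Type*}

/-- The word of letters written by a sequence of queue actions. -/
def writes : FreeMonoid (QueueAction A) →* FreeMonoid A :=
  FreeMonoid.lift fun x => match x with
    | .write a => FreeMonoid.of a
    | .read _ => 1

/-- The word of letters read by a sequence of queue actions. -/
def reads : FreeMonoid (QueueAction A) →* FreeMonoid A :=
  FreeMonoid.lift fun x => match x with
    | .write _ => 1
    | .read a => FreeMonoid.of a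

/-- The least length of a queue on which the given actions never read from the empty queue. -/
def requiredLength : List (QueueAction A) → ℕ
  | [] => 0
  -- Truncation matters: a written letter can serve only a later read, so a surplus of writes does
  -- not lower the requirement of earlier reads.
  | .write _ :: u => requiredLength u - 1
  | .read _ :: u => requiredLength u + 1

/-- Hence the action of a word is determined by its writes, its reads and its required length. -/
theorem queueRun_eq_some_iff (u : FreeMonoid (QueueAction A)) (q p : List A) :
    queueRun (some q) u = some p ↔
      q ++ (writes u).toList = (reads u).toList ++ p ∧ requiredLength u.toList ≤ q.length := by
  induction u using FreeMonoid.inductionOn' generalizing q with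
  | one => simp [queueRun, requiredLength]
  | of_mul x u ih =>
    rw [queueRun_mul]
    cases x with
    | write a =>
      have : queueRun (some q) (FreeMonoid.of (write a)) = some (q ++ [a]) := by
        simp [queueRun, step]
      rw [this, ih]
      simp [writes, reads, requiredLength]
    | read a =>
      cases q with
      | nil =>
        have : queueRun (some []) (FreeMonoid.of (read a)) = none := by
          simp [queueRun, step]
        rw [this, queueRun_none]
        simp [requiredLength]
      | cons b q =>
        by_cases hb : b = a
        · have : queueRun (some (b :: q)) (FreeMonoid.of (read a)) = some q := by
            simp [queueRun, step, hb]
          rw [this, ih]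
          simp [writes, reads, requiredLength, hb]
        · have : queueRun (some (b :: q)) (FreeMonoid.of (read a)) = none := by
            simp [queueRun, step, hb]
          rw [this, queueRun_none]
          simp [writes, reads, hb]

theorem requiredLength_le (u : FreeMonoid (QueueAction A)) :
    requiredLength u.toList ≤ (reads u).length := by
  induction u using FreeMonoid.inductionOn' with
  | one => simp [requiredLength]
  | of_mul x u ih =>
    cases x with
    | write a =>
      simp [reads, requiredLength] at ih ⊢
      omega
    | read a =>
      simp [reads, requiredLength, FreeMonoid.length_mul] at ih ⊢
      omega

theorem queueRun_reads_append (u : FreeMonoid (QueueAction A)) (q : List A) :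
    queueRun (some ((reads u).toList ++ q)) u = some (q ++ (writes u).toList) := by
  rw [queueRun_eq_some_iff]
  refine ⟨by simp, ?_⟩
  have := requiredLength_le u
  rw [List.length_append]
  exact this.trans (Nat.le_add_right _ _)

theorem length_of_queueRun {u : FreeMonoid (QueueAction A)} {q p : List A}
    (h : queueRun (some q) u = some p) :
    q.length + (writes u).length = (reads u).length + p.length := by
  have := congrArg List.length ((queueRun_eq_some_iff u q p).1 h).1
  rwa [List.length_append, List.length_append] at this

/-- Running both words on the queue `reads u` followed by an arbitrary `q` gives an equation in `q`
that forces the shorter word of reads to be all of the longer one. -/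
theorem reads_eq_and_writes_eq [Nontrivial A] {u v : FreeMonoid (QueueAction A)}
    (h : queueCon A u v) : reads u = reads v ∧ writes u = writes v := by
  have main : ∀ {u v : FreeMonoid (QueueAction A)}, queueCon A u v →
      (reads u).length ≤ (reads v).length → reads u = reads v ∧ writes u = writes v := by
    intro u v h hl
    have h1 : ∀ q, ((reads u).toList ++ q) ++ (writes v).toList =
        (reads v).toList ++ (q ++ (writes u).toList) := fun q =>
      ((queueRun_eq_some_iff v _ _).1 ((h _).symm.trans (queueRun_reads_append u q))).1
    obtain ⟨s, hs⟩ : (reads u).toList <+: (reads v).toList := by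
      refine List.prefix_of_prefix_length_le (l₃ := (reads u).toList ++ (writes v).toList)
        (List.prefix_append _ _) ?_ hl
      have := h1 []
      simp only [List.append_nil] at this
      rw [this]
      exact List.prefix_append _ _
    have h2 : ∀ q, q ++ (writes v).toList = s ++ (q ++ (writes u).toList) := fun q => by
      have := h1 q
      rw [← hs, List.append_assoc, List.append_assoc] at this
      exact List.append_cancel_left this
    cases s with
    | nil =>
      refine ⟨FreeMonoid.toList.injective (by simpa using hs), FreeMonoid.toList.injective ?_⟩
      simpa using (h2 []).symm
    | cons b s =>
      -- For the queue `[c]` the two sides of `h2` begin with `c` and with `b`.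
      obtain ⟨c, hc⟩ := exists_ne b
      have := congrArg List.head? (h2 [c])
      simp at this
      exact absurd this hc
  rcases le_total (reads u).length (reads v).length with hl | hl
  · exact main h hl
  · exact ⟨(main ((queueCon A).symm h) hl).1.symm, (main ((queueCon A).symm h) hl).2.symm⟩

theorem queueRun_eq_of_requiredLength_le {u v : FreeMonoid (QueueAction A)}
    (hr : reads u = reads v) (hw : writes u = writes v) {q : List A}
    (h1 : requiredLength u.toList ≤ q.length) (h2 : requiredLength v.toList ≤ q.length) :
    queueRun (some q) u = queueRun (some q) v := by
  refine Option.ext fun p => ?_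
  rw [queueRun_eq_some_iff, queueRun_eq_some_iff, hr, hw]
  simp [h1, h2]

/-- Balanced words preserve the queue length, so a queue too short for `v` is still too short after
`u`; the second factor `v` then fails on both sides. -/
theorem queueCon_mul_self {u v : FreeMonoid (QueueAction A)}
    (hr : reads u = reads v) (hw : writes u = writes v)
    (hl : (writes v).length = (reads v).length)
    (h : requiredLength u.toList ≤ requiredLength v.toList) : queueCon A (u * v) (v * v) := by
  intro q
  rw [queueRun_mul, queueRun_mul]
  by_cases hq : requiredLength v.toList ≤ q.length
  · rw [queueRun_eq_of_requiredLength_le hr hw (h.trans hq) hq]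
  · have hv : queueRun (some q) v = none := by
      refine Option.eq_none_iff_forall_not_mem.2 fun p hp => hq ?_
      exact ((queueRun_eq_some_iff v q p).1 hp).2
    rw [hv, queueRun_none]
    cases hu : queueRun (some q) u with
    | none => rw [queueRun_none]
    | some p =>
      have hlen := length_of_queueRun hu
      rw [hr, hw] at hlen
      refine Option.eq_none_iff_forall_not_mem.2 fun p' hp' => hq ?_
      have := ((queueRun_eq_some_iff v p p').1 hp').2
      omega

theorem length_of_queueRun_pow {u : FreeMonoid (QueueAction A)} {n : ℕ} {q p : List A}
    (h : queueRun (some q) (u ^ n) = some p) :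
    q.length + n * (writes u).length = n * (reads u).length + p.length := by
  have := length_of_queueRun h
  rwa [map_pow, map_pow, FreeMonoid.length_pow, FreeMonoid.length_pow] at this

/-- Each copy of `u` lengthens the queue, so after `(reads u).length` copies it is long enough for
`u` and `v` to act alike. -/
theorem queueCon_pow_mul {u v : FreeMonoid (QueueAction A)}
    (hr : reads u = reads v) (hw : writes u = writes v)
    (hl : (reads u).length < (writes u).length) :
    queueCon A (u ^ (reads u).length * u) (u ^ (reads u).length * v) := by
  intro q
  rw [queueRun_mul, queueRun_mul]
  cases hp : queueRun (some q) (u ^ (reads u).length) with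
  | none => rw [queueRun_none, queueRun_none]
  | some p =>
    have h1 := length_of_queueRun_pow hp
    have h2 : (reads u).length ≤ p.length := by nlinarith
    exact queueRun_eq_of_requiredLength_le hr hw ((requiredLength_le u).trans h2)
      ((requiredLength_le v).trans (hr ▸ h2))

/-- Each copy of `u` shortens the queue, so a queue shorter than `(reads u).length` fails on both
sides, and on longer ones `u` and `v` act alike. -/
theorem queueCon_mul_pow {u v : FreeMonoid (QueueAction A)}
    (hr : reads u = reads v) (hw : writes u = writes v)
    (hl : (writes u).length < (reads u).length) :
    queueCon A (u * u ^ (reads u).length) (v * u ^ (reads u).length) := by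
  have key : ∀ w : FreeMonoid (QueueAction A), reads u = reads w → writes u = writes w →
      ∀ q : List A, q.length < (reads u).length →
      queueRun (some q) (w * u ^ (reads u).length) = none := by
    intro w hr hw q hq
    refine Option.eq_none_iff_forall_not_mem.2 fun p hp => ?_
    rw [queueRun_mul] at hp
    cases hp' : queueRun (some q) w with
    | none => rw [hp', queueRun_none] at hp; cases hp
    | some p' =>
      rw [hp'] at hp
      have h1 := length_of_queueRun hp'
      have h2 := length_of_queueRun_pow hp
      rw [← hr, ← hw] at h1
      nlinarith
  intro q
  rcases lt_or_ge q.length (reads u).length with hq | hq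
  · rw [key u rfl rfl q hq, key v hr hw q hq]
  · rw [queueRun_mul, queueRun_mul, queueRun_eq_of_requiredLength_le hr hw
      ((requiredLength_le u).trans hq) ((requiredLength_le v).trans (hr ▸ hq))]

end QueueAction

/-! ### Cancellative submonoids of the queue monoid. -/

namespace QueueMonoid

open QueueAction

variable {A : Type*}

/-- The morphism that maps a queue transformation to its words of writes and of reads. -/
def projections (A : Type*) [Nontrivial A] : QueueMonoid A →* FreeMonoid A × FreeMonoid A :=
  (queueCon A).lift (writes.prod reads) fun _ _ h =>
    Prod.ext (reads_eq_and_writes_eq h).2 (reads_eq_and_writes_eq h).1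

/-- Words with equal projections become equivalent after multiplication by a common factor lying in
the image of `f`; cancellation in `M` removes it. -/
theorem projections_comp_injective [Nontrivial A] {M : Type*} [Monoid M] [IsCancelMul M]
    (f : M →* QueueMonoid A) (hf : Function.Injective f) :
    Function.Injective ((projections A).comp f) := by
  intro x y hxy
  obtain ⟨u, hu⟩ := Con.mk'_surjective (f x)
  obtain ⟨v, hv⟩ := Con.mk'_surjective (f y)
  have congrMk : ∀ {w w' : FreeMonoid (QueueAction A)}, queueCon A w w' →
      (queueCon A).mk' w = (queueCon A).mk' w' := fun h => (Con.eq _).2 h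
  simp only [MonoidHom.comp_apply, ← hu, ← hv] at hxy
  have hw : writes u = writes v := congrArg Prod.fst hxy
  have hr : reads u = reads v := congrArg Prod.snd hxy
  rcases lt_trichotomy (reads u).length (writes u).length with h | h | h
  · have := congrMk (queueCon_pow_mul hr hw h)
    simp only [map_mul, map_pow, hu, hv] at this
    simp only [← map_mul, ← map_pow] at this
    exact mul_left_cancel (hf this)
  · rcases le_total (requiredLength u.toList) (requiredLength v.toList) with hl | hl
    · have := congrMk (queueCon_mul_self hr hw (by rw [← hr, ← hw, h]) hl)
      simp only [map_mul, hu, hv] at this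
      simp only [← map_mul] at this
      exact mul_right_cancel (hf this)
    · have := congrMk (queueCon_mul_self hr.symm hw.symm h.symm hl)
      simp only [map_mul, hu, hv] at this
      simp only [← map_mul] at this
      exact (mul_right_cancel (hf this)).symm
  · have := congrMk (queueCon_mul_pow hr hw h)
    simp only [map_mul, map_pow, hu, hv] at this
    simp only [← map_mul, ← map_pow] at this
    exact mul_right_cancel (hf this)

end QueueMonoid

/-! ### Projections and cancellation for traces. -/

namespace TraceMonoid

open FreeMonoid

variable {Γ : Type*} {G : SimpleGraph Γ}

/-- The trace of a word. -/
def mk (G : SimpleGraph Γ) : FreeMonoid Γ →* TraceMonoid G := (traceCon G).mk'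

theorem mk_surjective : Function.Surjective (mk G) := Con.mk'_surjective

theorem commute_of_adj {a b : Γ} (h : G.Adj a b) : Commute (mk G (of a)) (mk G (of b)) :=
  (Con.eq _).2 (ConGen.Rel.of _ _ ⟨a, b, h, rfl, rfl⟩)

/-- The morphism on traces induced by a map on letters under which adjacent letters commute. -/
def lift {M : Type*} [Monoid M] (f : Γ → M) (hf : ∀ a b, G.Adj a b → Commute (f a) (f b)) :
    TraceMonoid G →* M :=
  (traceCon G).lift (FreeMonoid.lift f) <| Con.conGen_le.2 <| by
    rintro _ _ ⟨a, b, h, rfl, rfl⟩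
    simpa using (hf a b h).eq

theorem lift_mk {M : Type*} [Monoid M] (f : Γ → M)
    (hf : ∀ a b, G.Adj a b → Commute (f a) (f b)) (u : FreeMonoid Γ) :
    lift f hf (mk G u) = FreeMonoid.lift f u := rfl

/-- The projection of a trace to an independent set of letters. -/
noncomputable def proj (S : Set Γ) (hS : ∀ a ∈ S, ∀ b ∈ S, ¬ G.Adj a b) :
    TraceMonoid G →* FreeMonoid Γ :=
  lift (fun a => restrict S (of a)) fun a b hab => by
    by_cases ha : a ∈ S
    · have hb : b ∉ S := fun hb => hS a ha b hb hab
      rw [restrict_of_notMem hb]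
      exact Commute.one_right _
    · rw [restrict_of_notMem ha]
      exact Commute.one_left _

theorem proj_mk (S : Set Γ) (hS : ∀ a ∈ S, ∀ b ∈ S, ¬ G.Adj a b) (u : FreeMonoid Γ) :
    proj S hS (mk G u) = restrict S u := by
  rw [proj, lift_mk]
  exact DFunLike.congr_fun (FreeMonoid.hom_eq (f := FreeMonoid.lift fun a => restrict S (of a))
    fun a => by simp) u

/-- Projection to a pair of non-adjacent letters. -/
noncomputable def projPair {a b : Γ} (h : ¬ G.Adj a b) : TraceMonoid G →* FreeMonoid Γ :=
  proj {a, b} <| by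
    rintro x (rfl | rfl) y (rfl | rfl)
    · exact G.irrefl
    · exact h
    · exact fun h' => h h'.symm
    · exact G.irrefl

theorem projPair_mk {a b : Γ} (h : ¬ G.Adj a b) (u : FreeMonoid Γ) :
    projPair h (mk G u) = restrict {a, b} u := proj_mk _ _ _

theorem mk_mul_of_comm {a : Γ} {s : FreeMonoid Γ} (h : ∀ b ∈ s.toList, G.Adj b a) :
    Commute (mk G s) (mk G (of a)) := by
  induction s using FreeMonoid.inductionOn' with
  | one => simp
  | of_mul b s ih =>
    rw [map_mul]
    refine (commute_of_adj (h b (by simp))).mul_left (ih fun c hc => h c ?_)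
    simp [hc]

theorem restrict_head {S : Set Γ} {s t : FreeMonoid Γ} {d : Γ} (hs : ∀ b ∈ s.toList, b ∉ S)
    (hd : d ∈ S) : restrict S (s * (of d * t)) = of d * restrict S t := by
  rw [map_mul, map_mul, restrict_of_mem hd]
  have : restrict S s = 1 := by
    induction s using FreeMonoid.inductionOn' with
    | one => simp
    | of_mul b s ih =>
      rw [map_mul, restrict_of_notMem (hs b (by simp)), one_mul]
      exact ih fun c hc => hs c (by simp [hc])
  rw [this, one_mul]

/-- The first letter `a` of `u` occurs in `v`. Were some letter before its first occurrence not
adjacent to `a`, the first such letter `e` would start the projection of `v` to {e, a}, whereas that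
of `u` starts with `a`. So `a` moves to the front of `v` and cancels. -/
theorem eq_of_restrict_pair_eq (u v : FreeMonoid Γ)
    (h : ∀ a b : Γ, ¬ G.Adj a b → restrict {a, b} u = restrict {a, b} v) :
    mk G u = mk G v := by
  induction u using FreeMonoid.inductionOn' generalizing v with
  | one =>
    cases v using FreeMonoid.casesOn with
    | one => rfl
    | of_mul b v =>
      have := h b b G.irrefl
      rw [map_one, map_mul, restrict_of_mem (by simp)] at this
      have := congrArg length this
      simp [length_mul] at this
      omega
  | of_mul a u ih =>
    have hav : a ∈ v.toList := by
      by_contra hav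
      have h1 := h a a G.irrefl
      have : restrict {a, a} v = 1 := by
        clear h h1
        induction v using FreeMonoid.inductionOn' with
        | one => simp
        | of_mul b v ih =>
          simp only [toList_mul, toList_of, List.mem_append, List.mem_singleton, not_or] at hav
          rw [map_mul, restrict_of_notMem (by simpa [eq_comm] using hav.1), ih hav.2, one_mul]
      rw [this, map_mul, restrict_of_mem (by simp)] at h1
      exact absurd (congrArg length h1) (by simp [length_mul])
    obtain ⟨s, t, hst, has⟩ := List.eq_append_cons_of_mem hav
    replace hst : v = ofList s * (of a * ofList t) := hst
    have hadj : ∀ d ∈ s, G.Adj d a := by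
      intro d hd
      by_contra hda
      obtain ⟨s1, e, s2, hs, hs1, he⟩ : ∃ s1 e s2, s = s1 ++ e :: s2 ∧
          (∀ x ∈ s1, G.Adj x a) ∧ ¬ G.Adj e a := by
        clear hst has hav
        induction s with
        | nil => simp at hd
        | cons x s ihs =>
          by_cases hx : G.Adj x a
          · have hne : d ∈ s := by
              rcases List.mem_cons.1 hd with rfl | h'
              · exact absurd hx hda
              · exact h'
            obtain ⟨s1, e, s2, rfl, h1, h2⟩ := ihs hne
            exact ⟨x :: s1, e, s2, rfl, by simpa [hx] using h1, h2⟩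
          · exact ⟨[], x, s, rfl, by simp, hx⟩
      have h1 := h e a he
      have hse : e ≠ a := by
        rintro rfl
        exact has (by rw [hs]; simp)
      have hv : v = ofList s1 * (of e * (ofList s2 * (of a * ofList t))) := by
        rw [hst, hs]
        simp [ofList_append, ofList_cons, mul_assoc]
      have h2 : ∀ b ∈ (ofList s1).toList, b ∉ ({e, a} : Set Γ) := by
        rintro b hb (rfl | rfl)
        · exact he (hs1 _ hb)
        · exact G.irrefl (hs1 _ hb)
      rw [hv, restrict_head h2 (by simp), map_mul, restrict_of_mem (by simp)] at h1
      have h3 := congrArg (fun z => z.toList.head?) h1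
      simp at h3
      exact hse h3.symm
    have hcomm : mk G v = mk G (of a * (ofList s * ofList t)) := by
      have := (mk_mul_of_comm (G := G) (s := ofList s) (a := a) hadj).eq
      rw [hst, map_mul, map_mul, ← mul_assoc, this, map_mul, map_mul, mul_assoc]
    rw [hcomm, map_mul, map_mul (mk G) (of a)]
    congr 1
    refine ih _ fun b c hbc => ?_
    have h1 := h b c hbc
    rw [← projPair_mk hbc, ← projPair_mk hbc, hcomm, projPair_mk, projPair_mk, map_mul,
      map_mul _ (of a)] at h1
    exact mul_left_cancel h1

theorem eq_of_projPair_eq {x y : TraceMonoid G}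
    (h : ∀ a b : Γ, ∀ hab : ¬ G.Adj a b, projPair hab x = projPair hab y) : x = y := by
  obtain ⟨u, rfl⟩ := mk_surjective x
  obtain ⟨v, rfl⟩ := mk_surjective y
  exact eq_of_restrict_pair_eq u v fun a b hab => by simpa only [projPair_mk] using h a b hab

instance isCancelMul : IsCancelMul (TraceMonoid G) where
  mul_left_cancel x y z h := eq_of_projPair_eq fun a b hab => by
    have h' := congrArg (projPair hab) h
    simp only [map_mul] at h'
    exact mul_left_cancel h'
  mul_right_cancel x y z h := eq_of_projPair_eq fun a b hab => by
    have h' := congrArg (projPair hab) h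
    simp only [map_mul] at h'
    exact mul_right_cancel h'

theorem not_commute_pow {a b : Γ} (hne : a ≠ b) (h : ¬ G.Adj a b) {m n : ℕ} (hm : m ≠ 0)
    (hn : n ≠ 0) : ¬ Commute (mk G (of a) ^ m) (mk G (of b) ^ n) := by
  intro hc
  have := hc.map (projPair h)
  simp only [map_pow, projPair_mk] at this
  rw [restrict_of_mem (by simp), restrict_of_mem (by simp)] at this
  exact not_commute_of_pow hne hm hn this

end TraceMonoid

/-! ### A product of two free monoids inside the queue monoid. -/

namespace FreeMonoid

theorem lift_injective_of_length_eq {ι α : Type*} {f : ι → FreeMonoid α}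
    (hf : Function.Injective f) {n : ℕ} (hn : 0 < n) (hl : ∀ i, (f i).length = n) :
    Function.Injective (lift f) := by
  intro x
  induction x using FreeMonoid.inductionOn' with
  | one =>
    intro y h
    cases y using FreeMonoid.casesOn with
    | one => rfl
    | of_mul a y =>
      have := congrArg length h
      simp [length_mul, hl] at this
      omega
  | of_mul a x ih =>
    intro y h
    cases y using FreeMonoid.casesOn with
    | one =>
      have := congrArg length h
      simp [length_mul, hl] at this
      omega
    | of_mul b y =>
      simp only [map_mul, lift_eval_of] at h
      obtain ⟨h1, h2⟩ := List.append_inj (show (f a).toList ++ (lift f x).toList =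
        (f b).toList ++ (lift f y).toList from h) ((hl a).trans (hl b).symm)
      rw [hf h1, ih h2]

theorem commute_lift {ι κ M : Type*} [Monoid M] {f : ι → M} {g : κ → M}
    (h : ∀ i j, Commute (f i) (g j)) (x : FreeMonoid ι) (y : FreeMonoid κ) :
    Commute (lift f x) (lift g y) := by
  induction x using FreeMonoid.inductionOn' with
  | one => simp
  | of_mul i x ih =>
    rw [map_mul, lift_eval_of]
    refine Commute.mul_left ?_ ih
    clear ih
    induction y using FreeMonoid.inductionOn' with
    | one => simp
    | of_mul j y ih =>
      rw [map_mul, lift_eval_of]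
      exact (h i j).mul_right ih

end FreeMonoid

namespace QueueMonoid

open QueueAction FreeMonoid

variable {A : Type*}

/-- With at least two letters in the queue, the writes and the reads do not interact. On a shorter
queue reading first fails; writing first fails too, because the double `a` puts `a` in the second
position, where `b` is to be read. -/
theorem queueCon_writes_reads {a b : A} (hab : a ≠ b) (u v : A) :
    queueCon A (ofList [write a, write a, write u] * ofList [read v, read b])
      (ofList [read v, read b] * ofList [write a, write a, write u]) := by
  intro q
  match q with
  | [] =>
    by_cases h : a = v
    · subst h; simp [queueRun, step, hab]
    · simp [queueRun, step, h]
  | [c] =>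
    by_cases h : c = v
    · subst h; simp [queueRun, step, hab]
    · simp [queueRun, step, h]
  | c :: d :: q =>
    by_cases h : c = v <;> by_cases h' : d = b <;> simp [queueRun, step, h, h']

theorem embedsInto_of_nontrivial (A : Type*) [Nontrivial A] :
    EmbedsInto (FreeMonoid (Fin 2) × FreeMonoid (Fin 2)) (QueueMonoid A) := by
  obtain ⟨a, b, hab⟩ := exists_pair_ne A
  have hinj : Function.Injective ![a, b] := by
    intro i j
    fin_cases i <;> fin_cases j <;> simp [hab, hab.symm]
  let α : Fin 2 → QueueMonoid A := fun i =>
    (queueCon A).mk' (ofList [write a, write a, write (![a, b] i)])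
  let β : Fin 2 → QueueMonoid A := fun j =>
    (queueCon A).mk' (ofList [read (![a, b] j), read b])
  have hcomm : ∀ i j, Commute (α i) (β j) := fun i j =>
    (Con.eq _).2 (queueCon_writes_reads hab _ _)
  refine ⟨(FreeMonoid.lift α).noncommCoprod (FreeMonoid.lift β) (commute_lift hcomm), ?_⟩
  let U : Fin 2 → FreeMonoid A := fun i => ofList [a, a, ![a, b] i]
  let V : Fin 2 → FreeMonoid A := fun j => ofList [![a, b] j, b]
  have hU : Function.Injective (FreeMonoid.lift U) :=
    lift_injective_of_length_eq (n := 3) (fun i j h => hinj (by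
      have : [a, a, ![a, b] i] = [a, a, ![a, b] j] := h
      simpa using this)) (by norm_num) fun _ => rfl
  have hV : Function.Injective (FreeMonoid.lift V) :=
    lift_injective_of_length_eq (n := 2) (fun i j h => hinj (by
      have : [![a, b] i, b] = [![a, b] j, b] := h
      simpa using this)) (by norm_num) fun _ => rfl
  have hα : ∀ x, projections A (FreeMonoid.lift α x) = (FreeMonoid.lift U x, 1) := fun x =>
    DFunLike.congr_fun (f := (projections A).comp (FreeMonoid.lift α))
      (g := (MonoidHom.inl _ _).comp (FreeMonoid.lift U)) (FreeMonoid.hom_eq fun i => rfl) x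
  have hβ : ∀ x, projections A (FreeMonoid.lift β x) = (1, FreeMonoid.lift V x) := fun x =>
    DFunLike.congr_fun (f := (projections A).comp (FreeMonoid.lift β))
      (g := (MonoidHom.inr _ _).comp (FreeMonoid.lift V)) (FreeMonoid.hom_eq fun i => rfl) x
  rintro ⟨x, y⟩ ⟨x', y'⟩ h
  have h' := congrArg (projections A) h
  simp only [MonoidHom.noncommCoprod_apply, map_mul, hα, hβ, Prod.mk_mul_mk, mul_one, one_mul,
    Prod.mk.injEq] at h'
  rw [hU h'.1, hV h'.2]

end QueueMonoid

/-! ### The rank bound for commuting elements. -/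

namespace FreeMonoid

variable {A M : Type*} [Monoid M]

/-- The three vectors of lengths under `p` and `q` are dependent in ℤ². The positive and negative
parts of the coefficients give two products with equal lengths in both components; these commute, so
their components coincide. -/
theorem exists_eq_of_commute_triple {p q : M →* FreeMonoid A}
    (hpq : ∀ x y, p x = p y → q x = q y → x = y) {x y z : M}
    (hxy : Commute x y) (hxz : Commute x z) (hyz : Commute y z) :
    ∃ i j k i' j' k' : ℕ, ¬ (i = i' ∧ j = j' ∧ k = k') ∧
      x ^ i * y ^ j * z ^ k = x ^ i' * y ^ j' * z ^ k' := by
  let w : Fin 3 → M := ![x, y, z]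
  let v : Fin 3 → (Fin 2 → ℤ) := fun i => ![((p (w i)).length : ℤ), ((q (w i)).length : ℤ)]
  have hv : ¬ LinearIndependent ℤ v := fun h => by
    have := h.fintype_card_le_finrank
    simp at this
  obtain ⟨g, hg, i₀, hi₀⟩ := Fintype.not_linearIndependent_iff.1 hv
  have h0 := congrFun hg 0
  have h1 := congrFun hg 1
  simp [v, w, Fin.sum_univ_three] at h0 h1
  have hcomm : ∀ i j k i' j' k' : ℕ,
      Commute (x ^ i * y ^ j * z ^ k) (x ^ i' * y ^ j' * z ^ k') := by
    intro i j k i' j' k'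
    have hx : ∀ n, Commute (x ^ n) (x ^ i' * y ^ j' * z ^ k') := fun n =>
      (((Commute.refl x).pow_pow _ _).mul_right (hxy.pow_pow _ _)).mul_right (hxz.pow_pow _ _)
    have hy : ∀ n, Commute (y ^ n) (x ^ i' * y ^ j' * z ^ k') := fun n =>
      ((hxy.symm.pow_pow _ _).mul_right ((Commute.refl y).pow_pow _ _)).mul_right
        (hyz.pow_pow _ _)
    have hz : ∀ n, Commute (z ^ n) (x ^ i' * y ^ j' * z ^ k') := fun n =>
      ((hxz.symm.pow_pow _ _).mul_right (hyz.symm.pow_pow _ _)).mul_right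
        ((Commute.refl z).pow_pow _ _)
    exact ((hx i).mul_left (hy j)).mul_left (hz k)
  have hsplit : ∀ n : ℤ, n = (n.toNat : ℤ) - ((-n).toNat : ℤ) := fun n => by omega
  refine ⟨(g 0).toNat, (g 1).toNat, (g 2).toNat, (-g 0).toNat, (-g 1).toNat, (-g 2).toNat, ?_,
    hpq _ _ (eq_of_commute_of_length_eq ((hcomm _ _ _ _ _ _).map p) ?_)
      (eq_of_commute_of_length_eq ((hcomm _ _ _ _ _ _).map q) ?_)⟩
  · rintro ⟨e0, e1, e2⟩
    apply hi₀
    fin_cases i₀ <;> simp <;> omega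
  · rw [hsplit (g 0), hsplit (g 1), hsplit (g 2)] at h0
    simp only [map_mul, map_pow, length_mul, length_pow]
    zify
    linarith
  · rw [hsplit (g 0), hsplit (g 1), hsplit (g 2)] at h1
    simp only [map_mul, map_pow, length_mul, length_pow]
    zify
    linarith

end FreeMonoid

/-! ### Forbidden configurations and the shape of the graph. -/

namespace TraceMonoid

open FreeMonoid

variable {Γ A : Type*} {G : SimpleGraph Γ}

theorem mk_of_ne_one (a : Γ) : mk G (of a) ≠ 1 := by
  intro h
  have := congrArg (projPair (G.irrefl (v := a))) h
  rw [projPair_mk, restrict_of_mem (by simp), map_one] at this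
  exact of_ne_one a this

theorem not_commute {a b : Γ} (hne : a ≠ b) (h : ¬ G.Adj a b) :
    ¬ Commute (mk G (of a)) (mk G (of b)) := by
  simpa using not_commute_pow hne h one_ne_zero one_ne_zero

section Embedding

variable {p q : TraceMonoid G →* FreeMonoid A} (hpq : ∀ x y, p x = p y → q x = q y → x = y)
include hpq

theorem commute_of_components {x y : TraceMonoid G} (h1 : Commute (p x) (p y))
    (h2 : Commute (q x) (q y)) : Commute x y :=
  hpq _ _ (by simpa using h1.eq) (by simpa using h2.eq)

theorem no_triangle {a b c : Γ} (hab : G.Adj a b) (hac : G.Adj a c) (hbc : G.Adj b c) : False := by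
  obtain ⟨i, j, k, i', j', k', hne, h⟩ := exists_eq_of_commute_triple hpq
    (commute_of_adj hab) (commute_of_adj hac) (commute_of_adj hbc)
  -- Projection to the degenerate pair {d, d} counts the occurrences of `d`.
  have key := fun d => congrArg (fun x => (projPair (G.irrefl (v := d)) x).length) h
  simp only [map_mul, map_pow, projPair_mk, length_mul, length_pow] at key
  have self : ∀ d : Γ, (restrict {d, d} (of d)).length = 1 := fun d => by
    rw [restrict_of_mem (by simp), length_of]
  have other : ∀ d e : Γ, e ≠ d → (restrict {d, d} (of e)).length = 0 := fun d e h => by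
    rw [restrict_of_notMem (by simpa using h), length_one]
  have ha := key a
  have hb := key b
  have hc := key c
  rw [self, other _ _ hab.ne', other _ _ hac.ne'] at ha
  rw [self, other _ _ hab.ne, other _ _ hbc.ne'] at hb
  rw [self, other _ _ hac.ne, other _ _ hbc.ne] at hc
  omega

/-- If both components of `b` were nontrivial, `commute_trans` through `b` would make `a` and `c`
commute. -/
theorem eq_one_or_eq_one {a b c : Γ} (hab : G.Adj a b) (hbc : G.Adj b c) (hne : a ≠ c)
    (hac : ¬ G.Adj a c) : p (mk G (of b)) = 1 ∨ q (mk G (of b)) = 1 := by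
  by_contra! h
  exact not_commute hne hac (commute_of_components hpq
    (commute_trans h.1 ((commute_of_adj hab).map p) ((commute_of_adj hbc).map p))
    (commute_trans h.2 ((commute_of_adj hab).map q) ((commute_of_adj hbc).map q)))

/-- Suitable positive powers of `d` and `e` have the same image under `p`, while `q` erases `b`. So
dⁿbeᵐ and eᵐbdⁿ agree, but their projections to {b, d} do not. -/
theorem no_far_edge {b d e : Γ} (hb : q (mk G (of b)) = 1) (hde : G.Adj d e) (hdb : d ≠ b)
    (heb : e ≠ b) (hbd : ¬ G.Adj b d) (hbe : ¬ G.Adj b e) : False := by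
  have hp : ∀ c, c ≠ b → ¬ G.Adj b c → p (mk G (of c)) ≠ 1 := by
    intro c hcb hbc hc
    refine not_commute hcb.symm hbc (commute_of_components hpq ?_ ?_)
    · rw [hc]; exact Commute.one_right _
    · rw [hb]; exact Commute.one_left _
  have hdn := length_pos_of_ne_one (hp d hdb hbd)
  have hen := length_pos_of_ne_one (hp e heb hbe)
  set m := (p (mk G (of d))).length
  set n := (p (mk G (of e))).length
  have hcomm := commute_of_adj hde
  have hpow : p (mk G (of d)) ^ n = p (mk G (of e)) ^ m :=
    pow_length_eq_of_commute (hcomm.map p)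
  have h : mk G (of d) ^ n * mk G (of b) * mk G (of e) ^ m =
      mk G (of e) ^ m * mk G (of b) * mk G (of d) ^ n := by
    apply hpq
    · simp only [map_mul, map_pow, hpow]
    · simp only [map_mul, map_pow, hb, mul_one]
      exact ((hcomm.map q).pow_pow n m).eq
  have h' := congrArg (projPair hbd) h
  simp only [map_mul, map_pow, projPair_mk] at h'
  rw [restrict_of_mem (a := b) (by simp), restrict_of_mem (a := d) (by simp),
    restrict_of_notMem (a := e) (by simp [heb, hde.ne']), one_pow, one_mul, mul_one] at h'
  exact not_commute_of_pow hdb hen.ne' one_ne_zero (by rw [pow_one]; exact h')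

/-- The exponents are chosen so that aᵐ and bⁱ agree under `p`, and cʲ and dⁿ under `q`. Then
cʲaᵐdⁿbⁱ and its reversal bⁱdⁿaᵐcʲ agree in both components, although their projections to {a, d}
differ. -/
theorem no_path_of_eq_one {a b c d : Γ} (hab : G.Adj a b) (hcd : G.Adj c d) (hne : a ≠ d)
    (had : ¬ G.Adj a d) (hb : q (mk G (of b)) = 1) (hc : p (mk G (of c)) = 1) : False := by
  have hbd : b ≠ d := fun h => had (h ▸ hab)
  have hca : c ≠ a := fun h => had (h ▸ hcd)
  have hwb : p (mk G (of b)) ≠ 1 := fun h =>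
    mk_of_ne_one b (hpq _ 1 (by rw [h, map_one]) (by rw [hb, map_one]))
  have hwc : q (mk G (of c)) ≠ 1 := fun h =>
    mk_of_ne_one c (hpq _ 1 (by rw [hc, map_one]) (by rw [h, map_one]))
  have hA := pow_length_eq_of_commute ((commute_of_adj hab).map p)
  have hD := pow_length_eq_of_commute ((commute_of_adj hcd).symm.map q)
  have hm := length_pos_of_ne_one hwb
  have hn := length_pos_of_ne_one hwc
  set m := (p (mk G (of b))).length
  set n := (q (mk G (of c))).length
  set i := (p (mk G (of a))).length
  set j := (q (mk G (of d))).length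
  have h : mk G (of c) ^ j * mk G (of a) ^ m * mk G (of d) ^ n * mk G (of b) ^ i =
      mk G (of b) ^ i * mk G (of d) ^ n * mk G (of a) ^ m * mk G (of c) ^ j := by
    apply hpq
    · simp only [map_mul, map_pow, hc, one_pow, one_mul, mul_one, hA]
    · simp only [map_mul, map_pow, hb, one_pow, one_mul, mul_one, hD]
  have h' := congrArg (projPair had) h
  simp only [map_mul, map_pow, projPair_mk] at h'
  rw [restrict_of_mem (a := a) (by simp), restrict_of_mem (a := d) (by simp),
    restrict_of_notMem (a := b) (by simp [hab.ne', hbd]),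
    restrict_of_notMem (a := c) (by simp [hca, hcd.ne]), one_pow, one_pow, one_mul, one_mul,
    mul_one, mul_one] at h'
  exact not_commute_of_pow hne hm.ne' hn.ne' h'

theorem no_same_side {a b c : Γ} (hab : G.Adj a b) (hbc : G.Adj b c) (hne : a ≠ c)
    (hac : ¬ G.Adj a c) (hb : q (mk G (of b)) = 1) (hc : q (mk G (of c)) = 1) : False := by
  have hwb : p (mk G (of b)) ≠ 1 := fun h =>
    mk_of_ne_one b (hpq _ 1 (by rw [h, map_one]) (by rw [hb, map_one]))
  refine not_commute hne hac (commute_of_components hpq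
    (commute_trans hwb ((commute_of_adj hab).map p) ((commute_of_adj hbc).map p)) ?_)
  rw [hc]
  exact Commute.one_right _

/-- Each inner vertex vanishes under `p` or `q`; `no_same_side` excludes the same morphism for both,
`no_path_of_eq_one` different ones. -/
theorem no_induced_path {a b c d : Γ} (hab : G.Adj a b) (hbc : G.Adj b c) (hcd : G.Adj c d)
    (hac : ¬ G.Adj a c) (hbd : ¬ G.Adj b d) (had : ¬ G.Adj a d) : False := by
  have hac' : a ≠ c := fun h => had (h ▸ hcd)
  have hbd' : b ≠ d := fun h => had (h ▸ hab)
  have had' : a ≠ d := fun h => hac (h ▸ hcd.symm)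
  have hqp : ∀ x y, q x = q y → p x = p y → x = y := fun x y h1 h2 => hpq x y h2 h1
  rcases eq_one_or_eq_one hpq hab hbc hac' hac with hb | hb <;>
    rcases eq_one_or_eq_one hpq hbc hcd hbd' hbd with hc | hc
  · exact no_same_side hqp hab hbc hac' hac hb hc
  · exact no_path_of_eq_one hqp hab hcd had' had hb hc
  · exact no_path_of_eq_one hpq hab hcd had' had hb hc
  · exact no_same_side hpq hab hbc hac' hac hb hc

theorem no_edge_far_from_branching {a b c d e : Γ} (hab : G.Adj a b) (hbc : G.Adj b c)
    (hne : a ≠ c) (hde : G.Adj d e) (hbd : ¬ G.Adj b d) (hbe : ¬ G.Adj b e) : False := by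
  have hdb : d ≠ b := fun h => hbe (h ▸ hde)
  have heb : e ≠ b := fun h => hbd (h ▸ hde.symm)
  have hqp : ∀ x y, q x = q y → p x = p y → x = y := fun x y h1 h2 => hpq x y h2 h1
  rcases eq_one_or_eq_one hpq hab hbc hne (fun h => no_triangle hpq hab h hbc) with hb | hb
  · exact no_far_edge hqp hb hde hdb heb hbd hbe
  · exact no_far_edge hpq hb hde hdb heb hbd hbe

theorem graph_condition :
    AllDegreesLeOne G ∨ HasUniqueNontrivialComponentCompleteBipartite G := by
  by_cases hdeg : AllDegreesLeOne G
  · exact Or.inl hdeg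
  right
  simp only [AllDegreesLeOne, not_forall, not_le] at hdeg
  obtain ⟨b, hb⟩ := hdeg
  obtain ⟨a, c, ha, hc, hne⟩ := Set.one_lt_encard_iff.1 hb
  rw [SimpleGraph.mem_neighborSet] at ha hc
  -- Every edge has an endpoint adjacent to `b`. This leaves a single nontrivial component and makes
  -- the non-neighbours of `b` independent.
  have hedge : ∀ d e, G.Adj d e → ¬ G.Adj b d → G.Adj b e := fun d e hde hbd => by
    by_contra hbe
    exact no_edge_far_from_branching hpq ha.symm hc hne hde hbd hbe
  have hnbr : ∀ C : G.ConnectedComponent, C.supp.Nontrivial → ∀ x ∈ C.supp, ∃ z, G.Adj x z := by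
    intro C hC x hx
    obtain ⟨y, hy, hyx⟩ := hC.exists_ne x
    obtain ⟨w⟩ := SimpleGraph.ConnectedComponent.exact (hx.trans hy.symm)
    cases w with
    | nil => exact absurd rfl hyx
    | cons h _ => exact ⟨_, h⟩
  have hCb : (G.connectedComponentMk b).supp.Nontrivial :=
    ⟨b, rfl, a, SimpleGraph.ConnectedComponent.sound ha.symm.reachable, ha.ne⟩
  refine ⟨G.connectedComponentMk b, hCb, ?_, G.neighborSet b,
    (G.connectedComponentMk b).supp \ G.neighborSet b, Set.disjoint_sdiff_right, ?_, ?_⟩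
  · intro C hC
    obtain ⟨x, hx⟩ := hC.nonempty
    obtain ⟨z, hxz⟩ := hnbr C hC x hx
    rw [← SimpleGraph.ConnectedComponent.mem_supp_iff C x |>.1 hx]
    by_cases hbx : G.Adj b x
    · exact SimpleGraph.ConnectedComponent.sound hbx.symm.reachable
    · exact SimpleGraph.ConnectedComponent.sound
        (hxz.reachable.trans (hedge x z hxz hbx).symm.reachable)
  · refine Set.union_sdiff_cancel fun x hx => ?_
    exact SimpleGraph.ConnectedComponent.sound (SimpleGraph.Adj.reachable hx).symm
  · have hcomplete : ∀ x y, G.Adj b x → y ∈ (G.connectedComponentMk b).supp → ¬ G.Adj b y →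
        G.Adj x y := by
      intro x y hbx hy hby
      by_contra hxy
      obtain ⟨z, hyz⟩ := hnbr _ hCb y hy
      have hbz := hedge y z hyz hby
      -- A missing edge between the sides would make `x`, `b`, `z`, `y` an induced path.
      exact no_induced_path hpq hbx.symm hbz hyz.symm (fun h => no_triangle hpq hbx hbz h) hby hxy
    intro x hx y hy
    simp only [SimpleGraph.mem_neighborSet, Set.mem_sdiff, hx, hy, true_and]
    constructor
    · intro hxy
      by_cases hbx : G.Adj b x
      · exact Or.inl ⟨hbx, fun hby => no_triangle hpq hbx hby hxy⟩
      · exact Or.inr ⟨hbx, hedge x y hxy hbx⟩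
    · rintro (⟨h1, h2⟩ | ⟨h1, h2⟩)
      · exact hcomplete x y h1 hy h2
      · exact (hcomplete y x h2 hx h1).symm

end Embedding

end TraceMonoid

/-! ### Embeddings built from the graph condition. -/

namespace FreeMonoid

theorem pow_mul_eq_pow_mul {α : Type*} {c : α} {m n : ℕ} {x y : FreeMonoid α}
    (hx : x.toList.head? ≠ some c) (hy : y.toList.head? ≠ some c)
    (h : of c ^ m * x = of c ^ n * y) : m = n ∧ x = y := by
  induction m generalizing n with
  | zero =>
    cases n with
    | zero => simpa using h
    | succ n =>
      refine absurd (congrArg (fun z => z.toList.head?) h) ?_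
      simpa [pow_succ', mul_assoc] using hx
  | succ m ih =>
    cases n with
    | zero =>
      refine absurd (congrArg (fun z => z.toList.head?) h).symm ?_
      simpa [pow_succ', mul_assoc] using hy
    | succ n =>
      rw [pow_succ', pow_succ', mul_assoc, mul_assoc] at h
      obtain ⟨h1, h2⟩ := ih (mul_left_cancel h)
      exact ⟨by rw [h1], h2⟩

end FreeMonoid

namespace TraceMonoid

open FreeMonoid

variable {Γ : Type*} {G : SimpleGraph Γ}

theorem embedsInto_of_components {α : Type*} [Countable α]
    {p q : TraceMonoid G →* FreeMonoid α} (hpq : ∀ x y, p x = p y → q x = q y → x = y) :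
    EmbedsInto (TraceMonoid G) (FreeMonoid (Fin 2) × FreeMonoid (Fin 2)) := by
  obtain ⟨f, hf⟩ := exists_injective_hom_fin_two α
  exact ⟨(f.comp p).prod (f.comp q), fun x y h =>
    hpq x y (hf (congrArg Prod.fst h)) (hf (congrArg Prod.snd h))⟩

theorem embedsInto_of_completeBipartite [Countable Γ]
    (h : HasUniqueNontrivialComponentCompleteBipartite G) :
    EmbedsInto (TraceMonoid G) (FreeMonoid (Fin 2) × FreeMonoid (Fin 2)) := by
  obtain ⟨C, -, huniq, C₁, C₂, hdisj, hunion, hadj⟩ := h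
  have hcomp : ∀ a b, G.Adj a b → (a ∈ C₁ ∧ b ∈ C₂) ∨ (a ∈ C₂ ∧ b ∈ C₁) := by
    intro a b hab
    have hba : G.connectedComponentMk b = G.connectedComponentMk a :=
      SimpleGraph.ConnectedComponent.sound hab.symm.reachable
    have hC := huniq (G.connectedComponentMk a) ⟨a, rfl, b, hba, hab.ne⟩
    exact (hadj a hC b (hba.trans hC)).1 hab
  have h1 : ∀ a ∈ C₂ᶜ, ∀ b ∈ C₂ᶜ, ¬ G.Adj a b := fun a ha b hb hab => by
    rcases hcomp a b hab with h | h
    · exact hb h.2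
    · exact ha h.1
  have h2 : ∀ a ∈ C₁ᶜ, ∀ b ∈ C₁ᶜ, ¬ G.Adj a b := fun a ha b hb hab => by
    rcases hcomp a b hab with h | h
    · exact ha h.1
    · exact hb h.2
  have hsub₁ : C₁ ⊆ C.supp := hunion ▸ Set.subset_union_left
  have hsub₂ : C₂ ⊆ C.supp := hunion ▸ Set.subset_union_right
  -- The complements of `C₂` and `C₁` are independent, and isolated vertices lie in both. Every
  -- non-adjacent pair lies in one of them, so the two projections separate traces.
  have hcover : ∀ a b, ¬ G.Adj a b → ({a, b} : Set Γ) ⊆ C₂ᶜ ∨ ({a, b} : Set Γ) ⊆ C₁ᶜ := by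
    intro a b hab
    have hab' : ∀ x, x ∈ C₁ → x ∉ C₂ := fun _ hx => Set.disjoint_left.1 hdisj hx
    have h12 : a ∈ C₁ → b ∉ C₂ := fun ha hb =>
      hab ((hadj a (hsub₁ ha) b (hsub₂ hb)).2 (Or.inl ⟨ha, hb⟩))
    have h21 : a ∈ C₂ → b ∉ C₁ := fun ha hb =>
      hab ((hadj a (hsub₂ ha) b (hsub₁ hb)).2 (Or.inr ⟨ha, hb⟩))
    simp only [Set.insert_subset_iff, Set.singleton_subset_iff, Set.mem_compl_iff]
    have := hab' a
    have := hab' b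
    tauto
  refine embedsInto_of_components (p := proj _ h1) (q := proj _ h2) fun x y hx hy => ?_
  obtain ⟨u, rfl⟩ := mk_surjective x
  obtain ⟨v, rfl⟩ := mk_surjective y
  rw [proj_mk, proj_mk] at hx hy
  refine eq_of_restrict_pair_eq u v fun a b hab => ?_
  rcases hcover a b hab with h | h
  · rw [← restrict_restrict h u, hx, restrict_restrict h v]
  · rw [← restrict_restrict h u, hy, restrict_restrict h v]

theorem eq_or_adj_of_reachable (h : AllDegreesLeOne G) {a b : Γ} (hab : G.Reachable a b) :
    a = b ∨ G.Adj a b := by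
  obtain ⟨w⟩ := hab
  induction w with
  | nil => exact Or.inl rfl
  | cons hxz _ ih =>
    rcases ih with rfl | hzy
    · exact Or.inr hxz
    · exact Or.inl (Set.encard_le_one_iff.1 (h _) _ _ hxz.symm hzy)

/-- Split off a maximal prefix of letters from a given class. -/
theorem exists_mk_eq_pow_mul_pow_mul {α : Type*} {c : Γ → α} {a b : Γ}
    (hcomm : Commute (mk G (of a)) (mk G (of b))) (hclass : ∀ x, c x = c a → x = a ∨ x = b)
    (v : FreeMonoid Γ) : ∃ m n t, mk G v = mk G (of a) ^ m * mk G (of b) ^ n * mk G t ∧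
      t.length ≤ v.length ∧ (t = 1 ∨ ∃ x t', t = of x * t' ∧ c x ≠ c a) := by
  induction v using FreeMonoid.inductionOn' with
  | one => exact ⟨0, 0, 1, by simp, le_rfl, Or.inl rfl⟩
  | of_mul x v ih =>
    by_cases hx : c x = c a
    · obtain ⟨m, n, t, hv, hl, ht⟩ := ih
      have hl' : t.length ≤ (of x * v).length := by rw [length_mul]; omega
      rcases hclass x hx with rfl | rfl
      · exact ⟨m + 1, n, t, by rw [map_mul, hv, pow_succ']; simp only [mul_assoc], hl', ht⟩
      · refine ⟨m, n + 1, t, ?_, hl', ht⟩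
        rw [map_mul, hv, pow_succ', ← mul_assoc, ← mul_assoc, ← mul_assoc,
          (hcomm.pow_left m).eq]
    · exact ⟨0, 0, of x * v, by simp, le_rfl, Or.inr ⟨x, v, rfl, hx⟩⟩

/-- Components have at most two vertices, and the letters of one component commute. Each trace is
thus a sequence of blocks aᵐbᵏ, and the two morphisms record two independent linear forms in (m, k)
as exponents. -/
theorem embedsInto_of_allDegreesLeOne [Countable Γ] (h : AllDegreesLeOne G) :
    EmbedsInto (TraceMonoid G) (FreeMonoid (Fin 2) × FreeMonoid (Fin 2)) := by
  obtain ⟨e, he⟩ := exists_injective_nat Γ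
  have : Countable G.ConnectedComponent := inferInstanceAs (Countable (Quot G.Reachable))
  let c : Γ → G.ConnectedComponent := G.connectedComponentMk
  have hc : ∀ a b, G.Adj a b → c a = c b := fun a b hab =>
    SimpleGraph.ConnectedComponent.sound hab.reachable
  let p : TraceMonoid G →* FreeMonoid G.ConnectedComponent := lift (fun a => of (c a))
    fun a b hab => by rw [hc a b hab]
  -- The `+ 1` keeps every image nonempty, so the next block stays visible under `q` and bounds the
  -- current power.
  let q : TraceMonoid G →* FreeMonoid G.ConnectedComponent := lift (fun a => of (c a) ^ (e a + 1))
    fun a b hab => by rw [hc a b hab]; exact Commute.pow_pow_self _ _ _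
  have hp : ∀ a, p (mk G (of a)) = of (c a) := fun a => by simp [p, lift_mk]
  have hq : ∀ a, q (mk G (of a)) = of (c a) ^ (e a + 1) := fun a => by simp [q, lift_mk]
  have hclass : ∀ a, ∃ b, Commute (mk G (of a)) (mk G (of b)) ∧ c b = c a ∧
      ∀ x, c x = c a → x = a ∨ x = b := by
    intro a
    by_cases hb : ∃ b, G.Adj a b
    · obtain ⟨b, hab⟩ := hb
      refine ⟨b, commute_of_adj hab, (hc a b hab).symm, fun x hx => ?_⟩
      rcases eq_or_adj_of_reachable h (SimpleGraph.ConnectedComponent.exact hx.symm) with hx | hx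
      · exact Or.inl hx.symm
      · exact Or.inr (Set.encard_le_one_iff.1 (h a) _ _ hx hab)
    · refine ⟨a, Commute.refl _, rfl, fun x hx => ?_⟩
      rcases eq_or_adj_of_reachable h (SimpleGraph.ConnectedComponent.exact hx.symm) with hx | hx
      · exact Or.inl hx.symm
      · exact absurd ⟨x, hx⟩ hb
  have hhead : ∀ a (t : FreeMonoid Γ), (t = 1 ∨ ∃ x t', t = of x * t' ∧ c x ≠ c a) →
      (p (mk G t)).toList.head? ≠ some (c a) ∧ (q (mk G t)).toList.head? ≠ some (c a) := by
    rintro a t (rfl | ⟨x, t', rfl, hx⟩)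
    · simp
    · simp [hp, hq, pow_succ', mul_assoc, hx]
  suffices main : ∀ n (u v : FreeMonoid Γ), u.length ≤ n → p (mk G u) = p (mk G v) →
      q (mk G u) = q (mk G v) → mk G u = mk G v by
    refine embedsInto_of_components (p := p) (q := q) fun x y hx hy => ?_
    obtain ⟨u, rfl⟩ := mk_surjective x
    obtain ⟨v, rfl⟩ := mk_surjective y
    exact main _ u v le_rfl hx hy
  intro n
  induction n with
  | zero =>
    intro u v hu hpuv _
    obtain rfl := length_eq_zero.1 (Nat.le_zero.1 hu)
    cases v using FreeMonoid.casesOn with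
    | one => rfl
    | of_mul b v =>
      have := congrArg length hpuv
      simp [hp, length_mul] at this
      omega
  | succ n ih =>
    intro u v hu hpuv hquv
    cases u using FreeMonoid.casesOn with
    | one => exact ih 1 v (by simp) hpuv hquv
    | of_mul a u =>
      obtain ⟨b, hcomm, hcb, hab⟩ := hclass a
      obtain ⟨m, k, t, hut, htl, ht⟩ := exists_mk_eq_pow_mul_pow_mul (c := c) hcomm hab u
      obtain ⟨m', k', t', hvt, -, ht'⟩ := exists_mk_eq_pow_mul_pow_mul (c := c) hcomm hab v
      have hut' : mk G (of a * u) = mk G (of a) ^ (m + 1) * mk G (of b) ^ k * mk G t := by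
        rw [map_mul, hut, pow_succ']
        simp only [mul_assoc]
      rw [hut', hvt] at hpuv hquv ⊢
      simp only [map_mul, map_pow, hp, hq, hcb, ← pow_mul, ← pow_add] at hpuv hquv
      obtain ⟨h1, h2⟩ := pow_mul_eq_pow_mul (hhead a t ht).1 (hhead a t' ht').1 hpuv
      obtain ⟨h3, h4⟩ := pow_mul_eq_pow_mul (hhead a t ht).2 (hhead a t' ht').2 hquv
      rw [length_mul, length_of] at hu
      rw [ih t t' (by omega) h2 h4]
      congr 1
      -- For an isolated vertex only the sum of the exponents matters; otherwise `e a - e b`, up to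
      -- sign the determinant of the 2×2 system, is nonzero.
      by_cases hba : b = a
      · rw [hba, ← pow_add, ← pow_add, h1]
      · have hne : (e a : ℤ) - e b ≠ 0 := fun h0 => hba (he (by omega))
        have hm : ((m + 1 : ℕ) : ℤ) = m' := by
          apply mul_right_cancel₀ hne
          zify at h1 h3
          push_cast
          linear_combination h3 - (e b + 1) * h1
        have hm' : m + 1 = m' := by exact_mod_cast hm
        rw [hm', show k = k' by omega]

theorem embedsInto_freeMonoid_prod_of_graph_condition [Countable Γ]
    (h : AllDegreesLeOne G ∨ HasUniqueNontrivialComponentCompleteBipartite G) :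
    EmbedsInto (TraceMonoid G) (FreeMonoid (Fin 2) × FreeMonoid (Fin 2)) :=
  h.elim embedsInto_of_allDegreesLeOne embedsInto_of_completeBipartite

end TraceMonoid

/-! ### Conclusion. -/

theorem QueueMonoid.not_embedsInto_nat_cubed (A : Type*) [Nontrivial A] :
    ¬ EmbedsInto (Multiplicative (ℕ × ℕ × ℕ)) (QueueMonoid A) := by
  rintro ⟨f, hf⟩
  have hinj := projections_comp_injective f hf
  obtain ⟨i, j, k, i', j', k', hne, h⟩ := FreeMonoid.exists_eq_of_commute_triple
    (p := (MonoidHom.fst _ _).comp ((projections A).comp f))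
    (q := (MonoidHom.snd _ _).comp ((projections A).comp f))
    (fun x y h1 h2 => hinj (Prod.ext h1 h2))
    (Commute.all (Multiplicative.ofAdd ((1, 0, 0) : ℕ × ℕ × ℕ)) (.ofAdd (0, 1, 0)))
    (Commute.all _ (.ofAdd (0, 0, 1))) (Commute.all _ _)
  simp only [← ofAdd_nsmul, ← ofAdd_add, EmbeddingLike.apply_eq_iff_eq] at h
  simp at h
  exact hne h

theorem mainTheorem1 (A : Type*) [Nontrivial A] :
    (∀ (Γ : Type*) [Countable Γ] (G : SimpleGraph Γ),
      List.TFAE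
        [EmbedsInto (TraceMonoid G) (QueueMonoid A),
         EmbedsInto (TraceMonoid G) (FreeMonoid (Fin 2) × FreeMonoid (Fin 2)),
         AllDegreesLeOne G ∨ HasUniqueNontrivialComponentCompleteBipartite G]) ∧
    ¬ EmbedsInto (Multiplicative (ℕ × ℕ × ℕ)) (QueueMonoid A) := by
  refine ⟨fun Γ _ G => ?_, QueueMonoid.not_embedsInto_nat_cubed A⟩
  tfae_have 1 → 3 := by
    rintro ⟨f, hf⟩
    have hinj := QueueMonoid.projections_comp_injective f hf
    exact TraceMonoid.graph_condition
      (p := (MonoidHom.fst _ _).comp ((QueueMonoid.projections A).comp f))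
      (q := (MonoidHom.snd _ _).comp ((QueueMonoid.projections A).comp f))
      fun x y h1 h2 => hinj (Prod.ext h1 h2)
  tfae_have 3 → 2 := TraceMonoid.embedsInto_freeMonoid_prod_of_graph_condition
  tfae_have 2 → 1 := by
    rintro ⟨f, hf⟩
    obtain ⟨g, hg⟩ := QueueMonoid.embedsInto_of_nontrivial A
    exact ⟨g.comp f, hg.comp hf⟩
  tfae_finish
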